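/- Let $r,k\ge 1$ and $n\ge 0$ be integers and let $m=rn+k+1$. Let $\Pi_m^{r,k+1}$ be the lattice, ordered by refinement, that consists of all partitions of $[m]=\{1,\dots,m\}$ in which the block containing $m$ has at least $k+1$ elements and every block not containing $m$ has cardinality divisible by $r$, together with an adjoined minimal element $\hat 0$; its maximal element $\hat 1$ is the partition with the single block $[m]$. Let $\mu(\Pi_m^{r,k+1})=\mu(\hat 0,\hat 1)$ be its Möbius function. Then $$\mu(\Pi_m^{r,k+1})=(-1)^{n+1}\cdot\#\{\sigma\in S_{m-1}:\ \mathrm{Des}(\sigma)=\{r,2r,\dots,nr\}\},$$ where $\mathrm{Des}(\sigma)=\{i:\ 1\le i\le m-2,\ \sigma_i>\sigma_{i+1}\}$ is the descent set of $\sigma=\sigma_1\cdots\sigma_{m-1}$. Equivalently, $$\mu(\Pi_m^{r,k+1})=(-1)^{n+1}\cdot\beta\big((a^{r-1}b)^n a^{k-1}\big),$$ where, for a word $u=u_1\cdots u_{N-1}$ in the letters $a,b$, $\beta(u)$ is the number of permutations $\sigma\in S_N$ with descent word $u$, that is, with $u_i=a$ if $\sigma_i<\sigma_{i+1}$ and $u_i=b$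 if $\sigma_i>\sigma_{i+1}$, for $1\le i\le N-1$. -/

import Mathlib

/-- The partitions `π` of `[m] = {1, …, m}`, where `m = r * n + j`, such that the block containing
`m` has at least `j` elements and every block not containing `m` has cardinality divisible by `r`. -/
def ExtPartition (r n j : ℕ) : Type :=
  {P : Finpartition (Finset.Icc 1 (r * n + j)) //
    ∀ B ∈ P.parts, (r * n + j ∈ B → j ≤ B.card) ∧ (r * n + j ∉ B → r ∣ B.card)}

namespace ExtPartition

/-- The refinement order: `P ≤ Q` when every block of `P` is contained in a block of `Q`. -/
instance (r n j : ℕ) : PartialOrder (ExtPartition r n j) :=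
  inferInstanceAs (PartialOrder
    {P : Finpartition (Finset.Icc 1 (r * n + j)) //
      ∀ B ∈ P.parts, (r * n + j ∈ B → j ≤ B.card) ∧ (r * n + j ∉ B → r ∣ B.card)})

instance (r n j : ℕ) : Finite (ExtPartition r n j) :=
  inferInstanceAs (Finite
    {P : Finpartition (Finset.Icc 1 (r * n + j)) //
      ∀ B ∈ P.parts, (r * n + j ∈ B → j ≤ B.card) ∧ (r * n + j ∉ B → r ∣ B.card)})

noncomputable instance (r n j : ℕ) : DecidableEq (ExtPartition r n j) :=
  Classical.decEq _

theorem le_iff {r n j : ℕ} (P Q : ExtPartition r n j) :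
    P ≤ Q ↔ ∀ B ∈ P.1.parts, ∃ C ∈ Q.1.parts, B ⊆ C := by
  constructor
  · intro h B hB
    exact h hB
  · intro h B hB
    exact h B hB

/-- The partition with `[m]` as its only block is the maximal element. -/
instance (r n j : ℕ) : OrderTop (ExtPartition r n j) where
  top := ⟨⊤, by
    intro B hB
    have hB' : B = Finset.Icc 1 (r * n + j) :=
      Finset.mem_singleton.1 (Finpartition.parts_top_subset _ hB)
    subst hB'
    refine ⟨fun _ => by simp, fun h => ?_⟩
    have h0 : r * n + j = 0 := by
      by_contra h0
      exact h (Finset.mem_Icc.2 ⟨Nat.one_le_iff_ne_zero.2 h0, le_rfl⟩)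
    simp [h0]⟩
  le_top P := show P.1 ≤ ⊤ from le_top

/-- The partitions in question form an upper order ideal in the lattice of all partitions. -/
theorem upward {r n j : ℕ} (P : ExtPartition r n j)
    (Q : Finpartition (Finset.Icc 1 (r * n + j))) (hPQ : P.1 ≤ Q) :
    ∀ B ∈ Q.parts, (r * n + j ∈ B → j ≤ B.card) ∧ (r * n + j ∉ B → r ∣ B.card) := by
  intro B hB
  constructor
  · intro hm
    obtain ⟨C, hC, hmC⟩ := P.1.exists_mem (Q.le hB hm)
    obtain ⟨D, hD, hCD⟩ := hPQ hC
    have : D = B := Q.eq_of_mem_parts hD hB (hCD hmC) hm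
    subst this
    exact ((P.2 C hC).1 hmC).trans (Finset.card_le_card hCD)
  · intro hm
    have hcard : B.card = ∑ C ∈ P.1.parts with C ⊆ B, C.card := by
      have hU : B = (P.1.parts.filter (· ⊆ B)).biUnion id := by
        ext x
        simp only [Finset.mem_biUnion, Finset.mem_filter, id]
        constructor
        · intro hx
          obtain ⟨C, hC, hxC⟩ := P.1.exists_mem (Q.le hB hx)
          obtain ⟨D, hD, hCD⟩ := hPQ hC
          have : D = B := Q.eq_of_mem_parts hD hB (hCD hxC) hx
          subst this
          exact ⟨C, ⟨hC, hCD⟩, hxC⟩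
        · rintro ⟨C, ⟨_, hCB⟩, hxC⟩
          exact hCB hxC
      conv_lhs => rw [hU]
      rw [Finset.card_biUnion]
      · rfl
      · intro C hC D hD hne
        exact P.1.disjoint (Finset.mem_filter.1 hC).1 (Finset.mem_filter.1 hD).1 hne
    rw [hcard]
    refine Finset.dvd_sum fun C hC => ?_
    obtain ⟨hC, hCB⟩ := Finset.mem_filter.1 hC
    exact (P.2 C hC).2 fun h => hm (hCB h)

end ExtPartition

/-- The poset `Π_m^{r,j}`, `m = r * n + j`: the partitions in `ExtPartition r n j`, ordered by
refinement, together with a new minimal element `⊥`. -/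
abbrev ExtPartitionLattice (r n j : ℕ) : Type := WithBot (ExtPartition r n j)

namespace ExtPartitionLattice

theorem exists_isGLB {r n j : ℕ} (x y : ExtPartitionLattice r n j) :
    ∃ z, IsGLB {x, y} z := by
  induction x using WithBot.recBotCoe with
  | bot => exact ⟨⊥, by simp [IsGLB, IsGreatest, lowerBounds, upperBounds]⟩
  | coe P =>
    induction y using WithBot.recBotCoe with
    | bot => exact ⟨⊥, by simp [IsGLB, IsGreatest, lowerBounds, upperBounds]⟩
    | coe Q =>
      by_cases h : ∃ R : ExtPartition r n j, R ≤ P ∧ R ≤ Q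
      · obtain ⟨R, hRP, hRQ⟩ := h
        have hR : R.1 ≤ P.1 ⊓ Q.1 := le_inf hRP hRQ
        refine ⟨WithBot.some (show ExtPartition r n j from
          ⟨P.1 ⊓ Q.1, ExtPartition.upward R _ hR⟩), ?_, ?_⟩
        · rintro w (rfl | rfl)
          · exact WithBot.coe_le_coe.2 (show P.1 ⊓ Q.1 ≤ P.1 from inf_le_left)
          · exact WithBot.coe_le_coe.2 (show P.1 ⊓ Q.1 ≤ Q.1 from inf_le_right)
        · intro w hw
          have h1 := hw (Set.mem_insert _ _)
          have h2 := hw (Set.mem_insert_of_mem _ rfl)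
          induction w using WithBot.recBotCoe with
          | bot => exact bot_le
          | coe S =>
            exact WithBot.coe_le_coe.2 (show S.1 ≤ P.1 ⊓ Q.1 from
              le_inf (show S ≤ P from WithBot.coe_le_coe.1 h1)
                (show S ≤ Q from WithBot.coe_le_coe.1 h2))
      · refine ⟨⊥, fun w _ => bot_le, fun w hw => ?_⟩
        have h1 := hw (Set.mem_insert _ _)
        have h2 := hw (Set.mem_insert_of_mem _ rfl)
        induction w using WithBot.recBotCoe with
        | bot => exact le_rfl
        | coe S => exact absurd ⟨S, WithBot.coe_le_coe.1 h1, WithBot.coe_le_coe.1 h2⟩ h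

noncomputable instance (r n j : ℕ) : SemilatticeInf (ExtPartitionLattice r n j) where
  inf x y := (exists_isGLB x y).choose
  inf_le_left _ _ := (exists_isGLB _ _).choose_spec.1 (Set.mem_insert _ _)
  inf_le_right _ _ := (exists_isGLB _ _).choose_spec.1 (Set.mem_insert_of_mem _ rfl)
  le_inf _ _ _ h1 h2 := (exists_isGLB _ _).choose_spec.2 (by
    rintro w (rfl | rfl)
    · exact h1
    · exact h2)

noncomputable instance (r n j : ℕ) : Fintype (ExtPartitionLattice r n j) :=
  Fintype.ofFinite (Option (ExtPartition r n j))

open Classical in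
/-- A finite meet-semilattice with a greatest element is a lattice. -/
noncomputable instance (r n j : ℕ) : Lattice (ExtPartitionLattice r n j) where
  sup x y := (Finset.univ.filter fun z : ExtPartitionLattice r n j => x ≤ z ∧ y ≤ z).inf id
  le_sup_left _ _ := Finset.le_inf fun _ hz => (Finset.mem_filter.1 hz).2.1
  le_sup_right _ _ := Finset.le_inf fun _ hz => (Finset.mem_filter.1 hz).2.2
  sup_le _ _ z h1 h2 := Finset.inf_le (f := id) (Finset.mem_filter.2 ⟨Finset.mem_univ z, h1, h2⟩)

open Classical in
noncomputable instance (r n j : ℕ) : LocallyFiniteOrder (ExtPartitionLattice r n j) :=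
  Fintype.toLocallyFiniteOrder

open Classical in
/-- The Möbius function `μ(0̂, 1̂)` of the lattice `Π_m^{r,j}`, `m = r * n + j`. -/
noncomputable def moebius (r n j : ℕ) : ℤ :=
  IncidenceAlgebra.mu ℤ (⊥ : ExtPartitionLattice r n j) (⊤ : ExtPartitionLattice r n j)

end ExtPartitionLattice

/-- The descent set `{i : 1 ≤ i ≤ N - 1, σ_i > σ_{i+1}}` of a permutation `σ = σ_1 ⋯ σ_N`; the
element `i` of `{1, …, N}` is the element of `Fin N` with value `i - 1`. -/
def descentSet {N : ℕ} (σ : Equiv.Perm (Fin N)) : Set ℕ :=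
  {i | ∃ p q : Fin N, (p : ℕ) + 1 = i ∧ (q : ℕ) = i ∧ σ q < σ p}

/-- The letters of `ab`-words. -/
inductive ABLetter where
  | a
  | b
  deriving DecidableEq

/-- The descent word `u_1 ⋯ u_{N-1}` of `σ = σ_1 ⋯ σ_N`: the letter `u_i` is `a` if
`σ_i < σ_{i+1}` and `b` otherwise. -/
def descentWord {N : ℕ} (σ : Equiv.Perm (Fin N)) : List ABLetter :=
  List.ofFn fun i : Fin (N - 1) =>
    if σ ⟨i, by omega⟩ < σ ⟨i + 1, by omega⟩ then ABLetter.a else ABLetter.b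

/-- `β(u)` for an `ab`-word `u` of length `N - 1`: the number of permutations in `S_N` with descent
word `u`. -/
noncomputable def descentCount (u : List ABLetter) : ℕ :=
  Nat.card {σ : Equiv.Perm (Fin (u.length + 1)) // descentWord σ = u}

/-- The `ab`-word `(a^{r-1} b)^n a^{k-1}`, for `r, k ≥ 1`. -/
def blockWord (r n k : ℕ) : List ABLetter :=
  (List.replicate n (List.replicate (r - 1) ABLetter.a ++ [ABLetter.b])).flatten ++
    List.replicate (k - 1) ABLetter.a

/-! Above a partition `P` with `c` blocks the poset is the full partition lattice on these blocks,
because the admissible partitions form an up-set. Hence `μ(P, 1̂) = (-1)^(c-1) (c-1)!`, and `μ(0̂,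
1̂)` is minus the sum of these weights over all admissible partitions (`moebius_eq_neg_blockSum`).

The weighted sum obeys a recursion (`blockSum_rec`): a partition with `c` blocks has `c - 1` blocks
that avoid the point `m`, and the weight of `c` is `-(c-1)` times that of `c - 1`, except for `c =
1`. So the sum over partitions of `s` is `1` (if `s` itself is admissible) minus the sums over `s \
B`, for admissible nonempty `B` avoiding `m`.

Signed descent counts obey the same recursion (`alternating_sum_arrangementCount`). Let the first `r
* j` entries be a set `B` in increasing order, followed by an arrangement of the rest with descents
at all allowed multiples of `r`. Position `r * j` may or may not be a descent, so the count is a sum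
of two consecutive terms, and the alternating sum over `j` telescopes. Induction on `n` identifies
the two quantities (`blockSum_isBlock_eq`). -/

/-- The signed weight `(-1)^(c-1) (c-1)!` of a partition with `c` blocks. -/
def blockWeight (c : ℕ) : ℤ := (-1) ^ (c - 1) * (c - 1).factorial

/-- For `c = 1` the factor `c - 1` vanishes, so the value of `blockWeight 0` is irrelevant. -/
theorem blockWeight_rec {c : ℕ} (hc : 1 ≤ c) :
    blockWeight c = (if c = 1 then 1 else 0) - (c - 1 : ℕ) * blockWeight (c - 1) := by
  obtain ⟨c, rfl⟩ := Nat.exists_eq_add_of_le' hc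
  rcases c with _ | c
  · simp [blockWeight]
  · simp only [blockWeight, Nat.add_sub_cancel, Nat.factorial_succ, pow_succ]
    rw [if_neg (by omega)]
    push_cast
    ring

/-! ### Weighted sums over set partitions -/

section BlockSum

variable {α : Type*} [DecidableEq α]

theorem Finpartition.parts_avoid {s B : Finset α} (P : Finpartition s) (hB : B ∈ P.parts) :
    (P.avoid B).parts = P.parts.erase B := by
  ext D
  rw [Finpartition.mem_avoid, Finset.mem_erase]
  constructor
  · rintro ⟨E, hE, hEB, rfl⟩
    have hne : E ≠ B := fun h => hEB h.le
    have hdisj : Disjoint E B := P.disjoint hE hB hne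
    rw [Finset.sdiff_eq_self_of_disjoint hdisj]
    exact ⟨hne, hE⟩
  · rintro ⟨hne, hD⟩
    have hdisj : Disjoint D B := P.disjoint hD hB hne
    refine ⟨D, hD, fun h => P.ne_empty hD ?_, Finset.sdiff_eq_self_of_disjoint hdisj⟩
    exact Finset.disjoint_self_iff_empty _ |>.1 (hdisj.mono_right h)

theorem Finpartition.parts_eq_singleton_of_card {s : Finset α} (P : Finpartition s)
    (hP : P.parts.card = 1) : P.parts = {s} := by
  obtain ⟨B, hB⟩ := Finset.card_eq_one.1 hP
  have := P.biUnion_parts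
  rw [hB, Finset.singleton_biUnion] at this
  rw [hB, ← this]
  rfl

open Classical in
/-- The sum of the signed weights of the partitions of `s` with all blocks satisfying `C`. -/
noncomputable def blockSum (C : Finset α → Prop) (s : Finset α) : ℤ :=
  ∑ P : Finpartition s with ∀ B ∈ P.parts, C B, blockWeight P.parts.card

open Classical in
theorem sum_card_eq_one (C : Finset α → Prop) {s : Finset α} (hs : s.Nonempty) :
    ∑ P : Finpartition s with ∀ B ∈ P.parts, C B, (if P.parts.card = 1 then (1 : ℤ) else 0) =
      if C s then 1 else 0 := by
  let T : Finpartition s := Finpartition.indiscrete hs.ne_empty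
  have hT : T.parts = {s} := rfl
  have key : ∀ P : Finpartition s, P.parts.card = 1 ↔ P = T := fun P =>
    ⟨fun h => Finpartition.ext ((P.parts_eq_singleton_of_card h).trans hT.symm),
      fun h => by rw [h, hT, Finset.card_singleton]⟩
  simp only [key]
  rw [Finset.sum_ite_eq']
  simp [hT]

-- Deleting the block `B` is a bijection onto the admissible partitions of `s \ B`, and
-- `P.parts.card - 1` is the number of blocks that remain.
open Classical in
theorem sum_blockWeight_mem (C : Finset α → Prop) {s B : Finset α} (hB : B.Nonempty)
    (hBs : B ⊆ s) (hCB : C B) :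
    ∑ P : Finpartition s with (∀ D ∈ P.parts, C D) ∧ B ∈ P.parts,
      blockWeight (P.parts.card - 1) = blockSum C (s \ B) := by
  have hdisj : Disjoint (s \ B) B := Finset.sdiff_disjoint
  have hsup : (s \ B) ⊔ B = s := Finset.sdiff_union_of_subset hBs
  have hBQ : ∀ Q : Finpartition (s \ B), B ∉ Q.parts := fun Q hQ =>
    hB.ne_empty (Finset.disjoint_self_iff_empty _ |>.1 (hdisj.mono_left (Q.subset hQ)))
  refine Finset.sum_bij' (fun P _ => P.avoid B)
    (fun Q _ => Q.extend hB.ne_empty hdisj hsup) ?_ ?_ ?_ ?_ ?_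
  · intro P hP
    simp only [Finset.mem_filter, Finset.mem_univ, true_and] at hP ⊢
    rw [P.parts_avoid hP.2]
    exact fun D hD => hP.1 D (Finset.mem_of_mem_erase hD)
  · intro Q hQ
    simp only [Finset.mem_filter, Finset.mem_univ, true_and] at hQ ⊢
    refine ⟨fun D hD => ?_, Finset.mem_insert_self _ _⟩
    rcases Finset.mem_insert.1 hD with rfl | hD
    · exact hCB
    · exact hQ D hD
  · intro P hP
    simp only [Finset.mem_filter, Finset.mem_univ, true_and] at hP
    refine Finpartition.ext ?_
    change insert B (P.avoid B).parts = _
    rw [P.parts_avoid hP.2, Finset.insert_erase hP.2]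
  · intro Q hQ
    refine Finpartition.ext ?_
    rw [Finpartition.parts_avoid _ (Finset.mem_insert_self _ _)]
    exact Finset.erase_insert (hBQ Q)
  · intro P hP
    simp only [Finset.mem_filter, Finset.mem_univ, true_and] at hP
    rw [P.parts_avoid hP.2, Finset.card_erase_of_mem hP.2]

theorem Finpartition.card_filter_notMem {s : Finset α} (P : Finpartition s) {m : α} (hm : m ∈ s) :
    (P.parts.filter (m ∉ ·)).card = P.parts.card - 1 := by
  have : P.parts.filter (m ∉ ·) = P.parts.erase (P.part m) := by
    ext B
    simp only [Finset.mem_filter, Finset.mem_erase]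
    constructor
    · rintro ⟨hB, hmB⟩
      exact ⟨fun h => hmB (h ▸ P.mem_part_self.2 hm), hB⟩
    · rintro ⟨hne, hB⟩
      exact ⟨hB, fun h => hne (P.part_eq_of_mem hB h).symm⟩
  rw [this, Finset.card_erase_of_mem (P.part_mem.2 hm)]

open Classical in
/-- Recursion by removing a block that does not contain the distinguished element `m`. -/
theorem blockSum_rec (C : Finset α → Prop) {s : Finset α} {m : α} (hm : m ∈ s) :
    blockSum C s = (if C s then 1 else 0) -
      ∑ B ∈ (s.erase m).powerset with B.Nonempty ∧ C B, blockSum C (s \ B) := by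
  have hs : s.Nonempty := ⟨m, hm⟩
  rw [← sum_card_eq_one C hs]
  -- Double counting of pairs of a partition and one of its `c - 1` blocks avoiding `m`.
  have h1 : ∑ B ∈ (s.erase m).powerset with B.Nonempty ∧ C B, blockSum C (s \ B) =
      ∑ P : Finpartition s with ∀ B ∈ P.parts, C B,
        ((P.parts.card - 1 : ℕ) : ℤ) * blockWeight (P.parts.card - 1) := by
    have h2 : ∀ P : Finpartition s,
        ((P.parts.card - 1 : ℕ) : ℤ) * blockWeight (P.parts.card - 1) =
          ∑ _B ∈ P.parts with m ∉ _B, blockWeight (P.parts.card - 1) := fun P => by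
      rw [Finset.sum_const, P.card_filter_notMem hm, nsmul_eq_mul]
    simp only [h2]
    rw [Finset.sum_comm' (t' := (s.erase m).powerset.filter fun B => B.Nonempty ∧ C B)
      (s' := fun B => Finset.univ.filter fun P : Finpartition s =>
        (∀ D ∈ P.parts, C D) ∧ B ∈ P.parts)]
    · refine Finset.sum_congr rfl fun B hB => ?_
      simp only [Finset.mem_filter, Finset.mem_powerset] at hB
      exact (sum_blockWeight_mem C hB.2.1 (hB.1.trans (Finset.erase_subset _ _)) hB.2.2).symm
    · intro P B
      simp only [Finset.mem_filter, Finset.mem_univ, true_and, Finset.mem_powerset,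
        Finset.subset_erase]
      constructor
      · rintro ⟨hP, hB, hmB⟩
        exact ⟨⟨hP, hB⟩, ⟨P.subset hB, hmB⟩, P.nonempty_of_mem_parts hB, hP B hB⟩
      · rintro ⟨⟨hP, hB⟩, ⟨-, hmB⟩, -⟩
        exact ⟨hP, hB, hmB⟩
  rw [h1, ← Finset.sum_sub_distrib]
  exact Finset.sum_congr rfl fun P _ => blockWeight_rec (P.parts_nonempty hs.ne_empty).card_pos

/-- A finset is saturated for `P` when it is a union of blocks of `P`. -/
def Finpartition.Saturated {s : Finset α} (P : Finpartition s) (B : Finset α) : Prop :=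
  ∀ D ∈ P.parts, D ⊆ B ∨ Disjoint D B

theorem Finpartition.saturated_of_mem {s D : Finset α} (P : Finpartition s) (hD : D ∈ P.parts) :
    P.Saturated D := fun E hE => by
  by_cases h : E = D
  · exact Or.inl h.subset
  · exact Or.inr (P.disjoint hE hD h)

theorem Finpartition.Saturated.sdiff {s B D : Finset α} {P : Finpartition s}
    (hB : P.Saturated B) (hD : P.Saturated D) : P.Saturated (B \ D) := fun E hE => by
  rcases hB E hE with h | h
  · rcases hD E hE with h' | h'
    · exact Or.inr (Finset.disjoint_sdiff.mono_left h')
    · exact Or.inl (Finset.subset_sdiff.2 ⟨h, h'⟩)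
  · exact Or.inr (h.mono_right Finset.sdiff_subset)

-- By induction the only term surviving in `blockSum_rec` is `B = t \ P.part m`. It cancels the
-- leading `1`, unless it is empty and so does not occur in the sum.
open Classical in
theorem blockSum_saturated {s : Finset α} (P : Finpartition s) {m : α} (hm : m ∈ s)
    {t : Finset α} (hts : t ⊆ s) (hmt : m ∈ t) (ht : P.Saturated t) :
    blockSum P.Saturated t = if t = P.part m then 1 else 0 := by
  induction t using Finset.strongInduction with
  | H t ih =>
  have hD := P.part_mem.2 hm
  have hmD := P.mem_part_self.2 hm
  have hDt : P.part m ⊆ t := (ht _ hD).resolve_right fun h =>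
    Finset.disjoint_left.1 h hmD hmt
  rw [blockSum_rec _ hmt, if_pos ht]
  have h1 : ∀ B ∈ (t.erase m).powerset.filter fun B => B.Nonempty ∧ P.Saturated B,
      blockSum P.Saturated (t \ B) = if B = t \ P.part m then 1 else 0 := by
    intro B hB
    simp only [Finset.mem_filter, Finset.mem_powerset, Finset.subset_erase] at hB
    obtain ⟨⟨hBt, hmB⟩, hB0, hBs⟩ := hB
    rw [ih (t \ B) (Finset.sdiff_ssubset hBt hB0) (Finset.sdiff_subset.trans hts)
      (Finset.mem_sdiff.2 ⟨hmt, hmB⟩) (ht.sdiff hBs)]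
    refine if_congr ⟨fun h => ?_, fun h => ?_⟩ rfl rfl
    · rw [← h, Finset.sdiff_sdiff_eq_self hBt]
    · rw [h, Finset.sdiff_sdiff_eq_self hDt]
  rw [Finset.sum_congr rfl h1, Finset.sum_ite_eq']
  by_cases h : t = P.part m
  · rw [if_pos h, if_neg]
    · simp
    · simp [← h]
  · rw [if_neg h, if_pos]
    · simp
    · simp only [Finset.mem_filter, Finset.mem_powerset, Finset.subset_erase]
      refine ⟨⟨Finset.sdiff_subset, fun h' => (Finset.mem_sdiff.1 h').2 hmD⟩, ?_,
        ht.sdiff (P.saturated_of_mem hD)⟩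
      rw [Finset.sdiff_nonempty]
      exact fun h' => h (h'.antisymm hDt)

/-- This expresses being coarser than `P` as a condition on single blocks, so that the sum over an
up-set becomes a `blockSum`. -/
theorem Finpartition.le_iff_saturated {s : Finset α} (P Q : Finpartition s) :
    P ≤ Q ↔ ∀ B ∈ Q.parts, P.Saturated B := by
  constructor
  · intro h B hB D hD
    obtain ⟨E, hE, hDE⟩ := h hD
    rcases Q.saturated_of_mem hB E hE with h' | h'
    · exact Or.inl (hDE.trans h')
    · exact Or.inr (h'.mono_left hDE)
  · intro h D hD
    obtain ⟨x, hx⟩ := P.nonempty_of_mem_parts hD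
    obtain ⟨E, hE, hxE⟩ := Q.exists_mem (P.subset hD hx)
    exact ⟨E, hE, (h E hE D hD).resolve_right fun h' => Finset.disjoint_left.1 h' hx hxE⟩

open Classical in
/-- The signed weights sum to zero over the partitions that are coarser than `P`, unless `P` has
only one block. -/
theorem sum_blockWeight_ge {s : Finset α} (hs : s.Nonempty) (P : Finpartition s) :
    ∑ Q : Finpartition s with P ≤ Q, blockWeight Q.parts.card =
      if P.parts.card = 1 then 1 else 0 := by
  obtain ⟨m, hm⟩ := hs
  have hsat : P.Saturated s := fun D hD => Or.inl (P.subset hD)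
  have := blockSum_saturated P hm subset_rfl hm hsat
  simp only [blockSum, ← Finpartition.le_iff_saturated] at this
  rw [this]
  refine if_congr ⟨fun h => ?_, fun h => ?_⟩ rfl rfl
  · have hs : s ∈ P.parts := by
      have := P.part_mem.2 hm
      rwa [← h] at this
    refine Finset.card_eq_one.2 ⟨s, Finset.eq_singleton_iff_unique_mem.2 ⟨hs, fun B hB => ?_⟩⟩
    obtain ⟨x, hx⟩ := P.nonempty_of_mem_parts hB
    exact P.eq_of_mem_parts hB hs hx (P.subset hB hx)
  · have h' := P.parts_eq_singleton_of_card h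
    exact (P.part_eq_of_mem (by simp [h']) hm).symm

end BlockSum

/-! ### The Möbius function as a weighted sum -/

namespace ExtPartitionLattice

variable {r n j : ℕ}

theorem card_parts_eq_one_iff (hj : 1 ≤ j) (P : ExtPartition r n j) :
    P.1.parts.card = 1 ↔ P = ⊤ := by
  have hne : Finset.Icc 1 (r * n + j) ≠ ⊥ := by
    rw [Finset.bot_eq_empty, ← Finset.nonempty_iff_ne_empty, Finset.nonempty_Icc]
    omega
  have htop : ∀ Q : Finpartition (Finset.Icc 1 (r * n + j)), Q.parts.card = 1 → Q = ⊤ := by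
    intro Q hQ
    refine top_le_iff.1 fun B hB => ⟨_, ?_, Finpartition.subset _ hB⟩
    rw [Q.parts_eq_singleton_of_card hQ]
    exact Finset.mem_singleton_self _
  constructor
  · exact fun h => Subtype.ext (htop _ h)
  · rintro rfl
    have := Finset.card_le_card
      (Finpartition.parts_top_subset (Finset.Icc 1 (r * n + j)))
    rw [Finset.card_singleton] at this
    exact le_antisymm this (Finpartition.parts_nonempty _ hne).card_pos

/-- The condition on the blocks of the partitions in `ExtPartition r n j`. -/
def IsBlock (r m j : ℕ) (B : Finset ℕ) : Prop :=
  (m ∈ B → j ≤ B.card) ∧ (m ∉ B → r ∣ B.card)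

-- By `ExtPartition.upward`, everything coarser than `P` is admissible, so the interval up to `⊤` is
-- the same as in the lattice of all partitions.
open Classical in
theorem sum_coe_Icc (P : ExtPartition r n j) (f : ExtPartitionLattice r n j → ℤ)
    (g : Finpartition (Finset.Icc 1 (r * n + j)) → ℤ)
    (hfg : ∀ Q : ExtPartition r n j, P ≤ Q → f (WithBot.some Q) = g Q.1) :
    ∑ x ∈ Finset.Icc (WithBot.some P : ExtPartitionLattice r n j) ⊤, f x =
      ∑ Q : Finpartition (Finset.Icc 1 (r * n + j)) with P.1 ≤ Q, g Q := by
  symm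
  refine Finset.sum_bij (fun Q hQ => WithBot.some
    (⟨Q, P.upward Q (Finset.mem_filter.1 hQ).2⟩ : ExtPartition r n j)) ?_ ?_ ?_ ?_
  · intro Q hQ
    exact Finset.mem_Icc.2 ⟨WithBot.coe_le_coe.2 (Finset.mem_filter.1 hQ).2, le_top⟩
  · intro Q _ Q' _ h
    exact congrArg Subtype.val (WithBot.coe_injective h)
  · intro x hx
    obtain ⟨Q, rfl, hQ⟩ := WithBot.coe_le_iff.1 (Finset.mem_Icc.1 hx).1
    exact ⟨Q.1, Finset.mem_filter.2 ⟨Finset.mem_univ _, hQ⟩, rfl⟩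
  · intro Q hQ
    exact (hfg ⟨Q, P.upward Q (Finset.mem_filter.1 hQ).2⟩ (Finset.mem_filter.1 hQ).2).symm

open Classical in
theorem mu_coe_top (hj : 1 ≤ j) (P : ExtPartition r n j) :
    IncidenceAlgebra.mu ℤ (WithBot.some P : ExtPartitionLattice r n j) ⊤ =
      blockWeight P.1.parts.card := by
  have hne : (Finset.Icc 1 (r * n + j)).Nonempty := by
    rw [Finset.nonempty_Icc]
    omega
  induction P using WellFoundedGT.induction with
  | ind P ih =>
  -- `f` is `μ(·, ⊤)` with its value at `P` replaced by the expected one. Both functions have the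
  -- same sum over the interval from `P` to `⊤` and agree off `P`, hence also at `P`.
  let f : ExtPartitionLattice r n j → ℤ := fun x =>
    if x = WithBot.some P then blockWeight P.1.parts.card else IncidenceAlgebra.mu ℤ x ⊤
  have h1 : ∑ x ∈ Finset.Icc (WithBot.some P : ExtPartitionLattice r n j) ⊤, f x =
      if P = ⊤ then 1 else 0 := by
    rw [sum_coe_Icc P f (fun Q => blockWeight Q.parts.card), sum_blockWeight_ge hne]
    · exact if_congr (card_parts_eq_one_iff hj P) rfl rfl
    · intro Q hPQ
      simp only [f]
      split_ifs with h
      · rw [WithBot.coe_injective h]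
      · exact ih Q (lt_of_le_of_ne hPQ fun h' => h (h' ▸ rfl))
  have h2 := IncidenceAlgebra.sum_Icc_mu_left (𝕜 := ℤ) (WithBot.some P : ExtPartitionLattice r n j) ⊤
  have h3 : (WithBot.some P : ExtPartitionLattice r n j) = ⊤ ↔ P = ⊤ := WithBot.coe_eq_top
  rw [if_congr h3 rfl rfl, ← h1] at h2
  rw [← Finset.add_sum_erase _ _ (Finset.left_mem_Icc.2 le_top),
    ← Finset.add_sum_erase _ f (Finset.left_mem_Icc.2 le_top),
    Finset.sum_congr rfl fun x hx => show IncidenceAlgebra.mu ℤ x ⊤ = f x from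
      (if_neg (Finset.ne_of_mem_erase hx)).symm] at h2
  exact (add_right_cancel h2).trans (if_pos rfl)

open Classical in
theorem moebius_eq_neg_blockSum (hj : 1 ≤ j) :
    moebius r n j = -blockSum (IsBlock r (r * n + j) j) (Finset.Icc 1 (r * n + j)) := by
  have hne : (⊥ : ExtPartitionLattice r n j) ≠ ⊤ := WithBot.bot_ne_coe
  rw [moebius, IncidenceAlgebra.mu_eq_neg_sum_Ioc_of_ne hne, blockSum, neg_inj]
  symm
  refine Finset.sum_bij (fun Q hQ => WithBot.some
    (⟨Q, (Finset.mem_filter.1 hQ).2⟩ : ExtPartition r n j)) ?_ ?_ ?_ ?_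
  · intro Q hQ
    exact Finset.mem_Ioc.2 ⟨WithBot.bot_lt_coe _, le_top⟩
  · intro Q _ Q' _ h
    exact congrArg Subtype.val (WithBot.coe_injective h)
  · intro x hx
    obtain ⟨Q, rfl⟩ := WithBot.ne_bot_iff_exists.1 (Finset.mem_Ioc.1 hx).1.ne'
    exact ⟨Q.1, Finset.mem_filter.2 ⟨Finset.mem_univ _, Q.2⟩, rfl⟩
  · intro Q hQ
    exact (mu_coe_top hj ⟨Q, (Finset.mem_filter.1 hQ).2⟩).symm

end ExtPartitionLattice

/-! ### Linear arrangements and their descents -/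

section Arrangements

variable {α : Type*} [LinearOrder α]

/-- The linear arrangements of a finset. -/
def arrangements (X : Finset α) : Finset (List α) :=
  ⟨Multiset.lists X.val, Multiset.lists_nodup_finset X⟩

theorem mem_arrangements {X : Finset α} {l : List α} :
    l ∈ arrangements X ↔ l.Nodup ∧ l.toFinset = X := by
  change l ∈ Multiset.lists X.val ↔ _
  rw [Multiset.mem_lists_iff]
  constructor
  · intro h
    have hl : l.Nodup := by
      have := X.nodup
      rwa [h] at this
    refine ⟨hl, Finset.val_injective ?_⟩
    rw [List.toFinset_val, hl.dedup, h]
    rfl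
  · rintro ⟨hl, rfl⟩
    rw [List.toFinset_val, hl.dedup]
    rfl

theorem length_of_mem_arrangements {X : Finset α} {l : List α} (hl : l ∈ arrangements X) :
    l.length = X.card := by
  obtain ⟨h, rfl⟩ := mem_arrangements.1 hl
  exact (List.toFinset_card_of_nodup h).symm

/-- The entry with index `i` (counting from `0`) is followed by a smaller one. -/
def IsDesc (l : List α) (i : ℕ) : Prop := ∃ h : i + 1 < l.length, l[i + 1] < l[i]

theorem isDesc_drop (l : List α) (a i : ℕ) : IsDesc (l.drop a) i ↔ IsDesc l (a + i) := by
  simp only [IsDesc, List.getElem_drop, List.length_drop, ← add_assoc]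
  exact ⟨fun ⟨h, h'⟩ => ⟨by omega, h'⟩, fun ⟨h, h'⟩ => ⟨by omega, h'⟩⟩

theorem isDesc_take (l : List α) (a i : ℕ) : IsDesc (l.take a) i ↔ i + 1 < a ∧ IsDesc l i := by
  simp only [IsDesc, List.getElem_take, List.length_take]
  exact ⟨fun ⟨h, h'⟩ => ⟨by omega, by omega, h'⟩, fun ⟨h, h', h''⟩ => ⟨by omega, h''⟩⟩

theorem not_isDesc_iff_pairwise {l : List α} : (∀ i, ¬IsDesc l i) ↔ l.Pairwise (· ≤ ·) := by
  rw [← List.isChain_iff_pairwise, List.isChain_iff_getElem]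
  simp only [IsDesc, not_exists, not_lt]

theorem not_isDesc_iff_sort_eq {l : List α} (hl : l.Nodup) :
    (∀ i, ¬IsDesc l i) ↔ l.toFinset.sort = l := by
  rw [not_isDesc_iff_pairwise, List.toFinset_sort _ hl]

open Classical in
/-- The number of arrangements of `X` in which the set of positions (counting from `1`) of
descents is `D`. -/
noncomputable def arrangementCount (D : ℕ → Prop) (X : Finset α) : ℕ :=
  ((arrangements X).filter fun l => ∀ i, IsDesc l i ↔ D (i + 1)).card

theorem arrangementCount_congr {D D' : ℕ → Prop} (h : ∀ i, D (i + 1) ↔ D' (i + 1))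
    (X : Finset α) : arrangementCount D X = arrangementCount D' X := by
  classical
  exact congrArg Finset.card (Finset.filter_congr fun l _ => forall_congr' fun i => by rw [h i])

theorem arrangementCount_of_forall_not {D : ℕ → Prop} (h : ∀ i, ¬D (i + 1)) (X : Finset α) :
    arrangementCount D X = 1 := by
  rw [arrangementCount, Finset.card_eq_one]
  refine ⟨X.sort, Finset.ext fun l => ?_⟩
  simp only [Finset.mem_filter, mem_arrangements, Finset.mem_singleton, h, iff_false]
  constructor
  · rintro ⟨⟨hl, rfl⟩, hd⟩
    exact ((not_isDesc_iff_sort_eq hl).1 hd).symm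
  · rintro rfl
    refine ⟨⟨X.sort_nodup _, X.sort_toFinset _⟩, ?_⟩
    rw [not_isDesc_iff_sort_eq (X.sort_nodup _), X.sort_toFinset]

open Classical in
/-- An arrangement that ascends in its first `a` entries consists of a set of `a` entries and an
arrangement of the remaining ones. -/
theorem card_arrangements_prefix (D : ℕ → Prop) {X : Finset α} {a : ℕ} (ha : a ≤ X.card) :
    ((arrangements X).filter fun l =>
      ∀ i, i + 1 ≠ a → (IsDesc l i ↔ a < i + 1 ∧ D (i + 1 - a))).card =
      ∑ B ∈ X.powersetCard a, arrangementCount D (X \ B) := by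
  -- Position `a` is exempt from the condition, so prefix and remainder are independent: the fibre
  -- over `B` consists of `B` sorted, followed by any suitable arrangement of `X \ B`.
  rw [Finset.card_eq_sum_card_fiberwise (f := fun l => (l.take a).toFinset)
    (t := X.powersetCard a)]
  · refine Finset.sum_congr rfl fun B hB => ?_
    obtain ⟨hBX, hBa⟩ := Finset.mem_powersetCard.1 hB
    have hlen : B.sort.length = a := by rw [Finset.length_sort, hBa]
    refine Finset.card_nbij' (fun l => l.drop a) (fun l => B.sort ++ l) ?_ ?_ ?_ ?_
    · intro l hl
      simp only [Finset.coe_filter, Finset.mem_filter, Set.mem_ofPred_eq, mem_arrangements] at hl ⊢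
      obtain ⟨⟨⟨hn, rfl⟩, hd⟩, rfl⟩ := hl
      refine ⟨⟨hn.sublist (List.drop_sublist a l), ?_⟩, fun i => ?_⟩
      · have hdis := List.disjoint_take_drop hn (le_refl a)
        have h1 : l.toFinset = (l.take a).toFinset ∪ (l.drop a).toFinset := by
          rw [← List.toFinset_append, List.take_append_drop]
        rw [h1, Finset.union_sdiff_cancel_left]
        rwa [List.disjoint_toFinset_iff_disjoint]
      · rw [isDesc_drop, hd _ (by omega)]
        rw [show a + i + 1 - a = i + 1 by omega]
        exact and_iff_right (by omega)
    · intro l hl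
      simp only [Finset.coe_filter, Finset.mem_filter, Set.mem_ofPred_eq, mem_arrangements] at hl ⊢
      obtain ⟨⟨hn, hX⟩, hd⟩ := hl
      have htake : (B.sort ++ l).take a = B.sort := by rw [← hlen, List.take_left]
      have hdrop : (B.sort ++ l).drop a = l := by rw [← hlen, List.drop_left]
      refine ⟨⟨⟨?_, ?_⟩, fun i hi => ?_⟩, ?_⟩
      · refine List.nodup_append'.2 ⟨B.sort_nodup _, hn, ?_⟩
        rw [← List.disjoint_toFinset_iff_disjoint, Finset.sort_toFinset, hX]
        exact Finset.disjoint_sdiff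
      · rw [List.toFinset_append, Finset.sort_toFinset, hX, Finset.union_sdiff_of_subset hBX]
      · rcases lt_or_gt_of_ne hi with h | h
        · have hB' : ∀ i, ¬IsDesc B.sort i := by
            rw [not_isDesc_iff_sort_eq (B.sort_nodup _), B.sort_toFinset]
          have := hB' i
          rw [← htake, isDesc_take] at this
          exact iff_of_false (fun h' => this ⟨h, h'⟩) (fun h' => by omega)
        · obtain ⟨c, rfl⟩ := Nat.exists_eq_add_of_le (show a ≤ i by omega)
          rw [← isDesc_drop, hdrop, hd, show a + c + 1 - a = c + 1 by omega]
          exact (and_iff_right (by omega)).symm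
      · rw [htake, Finset.sort_toFinset]
    · intro l hl
      simp only [Finset.coe_filter, Finset.mem_filter, Set.mem_ofPred_eq, mem_arrangements] at hl
      obtain ⟨⟨⟨hn, -⟩, hd⟩, rfl⟩ := hl
      have h1 : (l.take a).toFinset.sort = l.take a := by
        refine (not_isDesc_iff_sort_eq (hn.sublist (List.take_sublist a l))).1 fun i h => ?_
        obtain ⟨h1, h2⟩ := (isDesc_take _ _ _).1 h
        have := ((hd i h1.ne).1 h2).1
        omega
      change (l.take a).toFinset.sort ++ l.drop a = l
      rw [h1, List.take_append_drop]
    · intro l _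
      change (B.sort ++ l).drop a = l
      rw [← hlen, List.drop_left]
  · intro l hl
    have hl' := (Finset.mem_filter.1 hl).1
    obtain ⟨hn, rfl⟩ := mem_arrangements.1 hl'
    rw [Finset.mem_coe, Finset.mem_powersetCard]
    refine ⟨fun x hx => ?_, ?_⟩
    · rw [List.mem_toFinset] at hx ⊢
      exact List.mem_of_mem_take hx
    · rw [List.toFinset_card_of_nodup (hn.sublist (List.take_sublist a l)), List.length_take,
        length_of_mem_arrangements hl']
      exact min_eq_left ha

/-- The multiples `r * t` of `r` with `j ≤ t ≤ n`. -/
def IsMultipleBetween (r j n p : ℕ) : Prop := r ∣ p ∧ r * j ≤ p ∧ p ≤ r * n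

/-- Descent positions of the part after the first `r * j` entries, translated to positions in the
whole arrangement; the cut itself is excluded. -/
theorem isMultipleBetween_add_iff {r : ℕ} (hr : 1 ≤ r) (j n p : ℕ) :
    r * j < p ∧ IsMultipleBetween r 0 n (p - r * j) ↔ IsMultipleBetween r (j + 1) (n + j) p := by
  simp only [IsMultipleBetween]
  constructor
  · rintro ⟨h, ⟨c, hc⟩, -, h'⟩
    obtain rfl : p = r * (c + j) := by rw [mul_add]; omega
    have hc : c ≠ 0 := by rintro rfl; simp at h
    have hcn : r * c ≤ r * n := by omega
    refine ⟨⟨_, rfl⟩, Nat.mul_le_mul_left _ (by omega), ?_⟩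
    rw [mul_add, mul_add]
    omega
  · rintro ⟨⟨c, rfl⟩, h, h'⟩
    have h1 := Nat.le_of_mul_le_mul_left h hr
    have h2 := Nat.le_of_mul_le_mul_left h' hr
    rw [← Nat.mul_sub]
    exact ⟨Nat.mul_lt_mul_of_pos_left (by omega) hr, ⟨_, rfl⟩, by simp,
      Nat.mul_le_mul_left _ (by omega)⟩

/-- The left side leaves position `r * j` free. The two terms on the right are the cases of a
descent there and of no descent there. -/
theorem sum_arrangementCount {r : ℕ} (hr : 1 ≤ r) {X : Finset α} {j n : ℕ} (hj : 1 ≤ j)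
    (hjn : j ≤ n) (hX : r * n ≤ X.card) :
    ∑ B ∈ X.powersetCard (r * j), arrangementCount (IsMultipleBetween r 0 (n - j)) (X \ B) =
      arrangementCount (IsMultipleBetween r j n) X +
        arrangementCount (IsMultipleBetween r (j + 1) n) X := by
  classical
  rw [← card_arrangements_prefix _ ((Nat.mul_le_mul_left r hjn).trans hX)]
  have hpos : 1 ≤ r * j := Nat.mul_pos hr hj
  have hsub : r * j - 1 + 1 = r * j := by omega
  have hM : IsMultipleBetween r j n (r * j) :=
    ⟨⟨j, rfl⟩, le_rfl, Nat.mul_le_mul_left _ hjn⟩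
  have hM' : ¬IsMultipleBetween r (j + 1) n (r * j) := fun h =>
    absurd (Nat.le_of_mul_le_mul_left h.2.1 hr) (by omega)
  have hMM : ∀ p, p ≠ r * j → (IsMultipleBetween r j n p ↔ IsMultipleBetween r (j + 1) n p) := by
    intro p hp
    simp only [IsMultipleBetween]
    refine and_congr_right fun ⟨c, hc⟩ => and_congr_left fun _ => ?_
    subst hc
    have hc : c ≠ j := fun h => hp (h ▸ rfl)
    rw [Nat.mul_le_mul_left_iff hr, Nat.mul_le_mul_left_iff hr]
    omega
  simp only [isMultipleBetween_add_iff hr, Nat.sub_add_cancel hjn]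
  rw [← Finset.card_filter_add_card_filter_not (fun l => IsDesc l (r * j - 1)),
    Finset.filter_filter, Finset.filter_filter, arrangementCount, arrangementCount]
  congr 2
  · refine Finset.filter_congr fun l _ => ⟨fun ⟨h, h'⟩ i => ?_, fun h => ⟨fun i hi => ?_, ?_⟩⟩
    · by_cases hi : i + 1 = r * j
      · obtain rfl : i = r * j - 1 := by omega
        rw [hsub]
        exact iff_of_true h' hM
      · rw [h i hi, hMM _ hi]
    · rw [h i, hMM _ hi]
    · rw [h, hsub]
      exact hM
  · refine Finset.filter_congr fun l _ => ⟨fun ⟨h, h'⟩ i => ?_, fun h => ⟨fun i hi => ?_, ?_⟩⟩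
    · by_cases hi : i + 1 = r * j
      · obtain rfl : i = r * j - 1 := by omega
        rw [hsub]
        exact iff_of_false h' hM'
      · rw [h i hi]
    · rw [h i]
    · rw [h, hsub]
      exact hM'

theorem sum_range_alternating (G : ℕ → ℤ) (n : ℕ) :
    ∑ j ∈ Finset.range n, (-1) ^ j * (G j + G (j + 1)) = G 0 - (-1) ^ n * G n := by
  induction n with
  | zero => simp
  | succ n ih => rw [Finset.sum_range_succ, ih, pow_succ]; ring

theorem alternating_sum_arrangementCount {r : ℕ} (hr : 1 ≤ r) {X : Finset α} {n : ℕ}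
    (hX : r * n ≤ X.card) :
    (-1 : ℤ) ^ n * arrangementCount (IsMultipleBetween r 0 n) X = 1 -
      ∑ j ∈ Finset.Icc 1 n, ∑ B ∈ X.powersetCard (r * j),
        (-1 : ℤ) ^ (n - j) * arrangementCount (IsMultipleBetween r 0 (n - j)) (X \ B) := by
  -- Positions start at `1`, so the multiple `0` plays no role.
  have h0 : arrangementCount (IsMultipleBetween r 0 n) X =
      arrangementCount (IsMultipleBetween r 1 n) X := by
    refine arrangementCount_congr (fun i => ?_) X
    simp only [IsMultipleBetween, mul_zero, mul_one, zero_le, true_and]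
    exact and_congr_right fun h => (and_iff_right (Nat.le_of_dvd (Nat.succ_pos _) h)).symm
  -- The far end of the telescope: no descent is allowed, which leaves only the increasing
  -- arrangement.
  have h1 : arrangementCount (IsMultipleBetween r (n + 1) n) X = 1 := by
    refine arrangementCount_of_forall_not (fun i h => ?_) X
    exact absurd (Nat.le_of_mul_le_mul_left (h.2.1.trans h.2.2) hr) (by omega)
  have h2 : ∑ j ∈ Finset.Icc 1 n, ∑ B ∈ X.powersetCard (r * j),
      (-1 : ℤ) ^ (n - j) * arrangementCount (IsMultipleBetween r 0 (n - j)) (X \ B) =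
      ∑ j ∈ Finset.range n, (-1 : ℤ) ^ n * -((-1) ^ j *
        ((arrangementCount (IsMultipleBetween r (j + 1) n) X : ℤ) +
          arrangementCount (IsMultipleBetween r (j + 1 + 1) n) X)) := by
    rw [show Finset.Icc 1 n = Finset.Ico (0 + 1) (n + 1) by ext; simp,
      ← Finset.sum_Ico_add', ← Finset.range_eq_Ico]
    refine Finset.sum_congr rfl fun j hj => ?_
    have hjn : j + 1 ≤ n := Finset.mem_range.1 hj
    rw [← Finset.mul_sum, ← Nat.cast_sum, sum_arrangementCount hr (by omega) hjn hX, Nat.cast_add]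
    obtain ⟨c, rfl⟩ := Nat.exists_eq_add_of_le hjn
    have h3 : (-1 : ℤ) ^ j * (-1) ^ j = 1 := by rw [← mul_pow]; simp
    rw [Nat.add_sub_cancel_left, pow_add, pow_succ]
    linear_combination (-(-1 : ℤ) ^ c * (arrangementCount
      (IsMultipleBetween r (j + 1) (j + 1 + c)) X + arrangementCount
      (IsMultipleBetween r (j + 1 + 1) (j + 1 + c)) X)) * h3
  rw [h2, ← Finset.mul_sum, Finset.sum_neg_distrib,
    sum_range_alternating (fun j => (arrangementCount (IsMultipleBetween r (j + 1) n) X : ℤ)),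
    h0, h1]
  have h3 : (-1 : ℤ) ^ n * (-1) ^ n = 1 := by rw [← mul_pow]; simp
  simp only [Nat.cast_one, zero_add]
  linear_combination h3

end Arrangements

/-! ### The weighted sum equals a signed descent count -/

open ExtPartitionLattice in
theorem blockSum_isBlock_of_card_lt {r m j : ℕ} {s : Finset ℕ} (hm : m ∈ s) (hs : s.card < j) :
    blockSum (IsBlock r m j) s = 0 := by
  classical
  rw [blockSum, Finset.filter_false_of_mem, Finset.sum_empty]
  intro P _ hP
  have h1 := (hP _ (P.part_mem.2 hm)).1 (P.mem_part_self.2 hm)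
  have h2 := Finset.card_le_card (P.part_subset m)
  omega

-- `blockSum_rec` and `alternating_sum_arrangementCount` are the same recursion: removing a block of
-- size `r * j` lowers `n` to `n - j` and keeps `k`.
open ExtPartitionLattice in
theorem blockSum_isBlock_eq {r : ℕ} (hr : 1 ≤ r) (k n : ℕ) {m : ℕ} {s : Finset ℕ} (hm : m ∈ s)
    (hs : s.card = r * n + k + 1) :
    blockSum (IsBlock r m (k + 1)) s =
      (-1) ^ n * arrangementCount (IsMultipleBetween r 0 n) (s.erase m) := by
  classical
  induction n using Nat.strong_induction_on generalizing s with
  | _ n ih =>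
  have hX : (s.erase m).card = r * n + k := by rw [Finset.card_erase_of_mem hm, hs]; rfl
  have hCs : IsBlock r m (k + 1) s := ⟨fun _ => by omega, fun h => absurd hm h⟩
  have hsdiff : ∀ B ⊆ s.erase m, m ∈ s \ B := fun B hB =>
    Finset.mem_sdiff.2 ⟨hm, fun h => Finset.notMem_erase m s (hB h)⟩
  have hcard : ∀ B ⊆ s.erase m, (s \ B).card + B.card = r * n + k + 1 := fun B hB => by
    rw [← hs]
    exact Finset.card_sdiff_add_card_eq_card (hB.trans (Finset.erase_subset _ _))
  rw [blockSum_rec _ hm, if_pos hCs, alternating_sum_arrangementCount hr (by omega)]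
  have hrec : ∀ j ∈ Finset.Icc 1 n, ∑ B ∈ (s.erase m).powersetCard (r * j),
      (-1 : ℤ) ^ (n - j) *
        arrangementCount (IsMultipleBetween r 0 (n - j)) (s.erase m \ B) =
      ∑ B ∈ (s.erase m).powersetCard (r * j), blockSum (IsBlock r m (k + 1)) (s \ B) := by
    intro j hj
    obtain ⟨hj1, hjn⟩ := Finset.mem_Icc.1 hj
    refine Finset.sum_congr rfl fun B hB => ?_
    obtain ⟨hBs, hBj⟩ := Finset.mem_powersetCard.1 hB
    rw [ih (n - j) (by omega) (hsdiff B hBs), Finset.erase_sdiff_comm]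
    have h1 := hcard B hBs
    obtain ⟨c, rfl⟩ := Nat.exists_eq_add_of_le hjn
    rw [hBj, mul_add] at h1
    rw [Nat.add_sub_cancel_left]
    omega
  rw [Finset.sum_congr rfl hrec, ← Finset.sum_biUnion]
  · congr 1
    symm
    -- The sets `B` of `blockSum_rec` have size `r * j` with `j ≥ 1`; those with `j > n` must be
    -- shown to contribute zero.
    refine Finset.sum_subset ?_ ?_
    · intro B hB
      simp only [Finset.mem_biUnion, Finset.mem_Icc, Finset.mem_powersetCard] at hB
      obtain ⟨j, ⟨hj, -⟩, hBs, hBj⟩ := hB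
      refine Finset.mem_filter.2 ⟨Finset.mem_powerset.2 hBs, ?_, fun h => ?_, fun _ => ⟨j, hBj⟩⟩
      · rw [← Finset.card_pos, hBj]
        exact Nat.mul_pos hr hj
      · exact absurd (hBs h) (Finset.notMem_erase m s)
    · intro B hB hB'
      simp only [Finset.mem_filter, Finset.mem_biUnion, Finset.mem_Icc,
        Finset.mem_powersetCard, Finset.mem_powerset, not_exists, not_and] at hB hB'
      obtain ⟨hBs, hB0, hB⟩ := hB
      obtain ⟨j, hj⟩ := hB.2 fun h => Finset.notMem_erase m s (hBs h)
      have hj0 : 1 ≤ j := by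
        rcases Nat.eq_zero_or_pos j with rfl | h
        · rw [mul_zero, Finset.card_eq_zero] at hj
          exact absurd hj hB0.ne_empty
        · exact h
      have hjn : n + 1 ≤ j := by
        by_contra h
        exact hB' j ⟨hj0, by omega⟩ hBs hj
      -- Fewer than `k + 1` elements remain, too few for the block of `m`.
      refine blockSum_isBlock_of_card_lt (hsdiff B hBs) ?_
      have h1 := hcard B hBs
      have h2 := Nat.mul_le_mul_left r hjn
      rw [mul_add] at h2
      omega
  · intro i _ j _ hij
    refine Finset.disjoint_left.2 fun B hi hj => hij ?_
    rw [Finset.mem_powersetCard] at hi hj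
    exact Nat.eq_of_mul_eq_mul_left hr (hi.2.symm.trans hj.2)

/-! ### Permutations, descent sets and descent words -/

theorem isDesc_ofFn_iff {N : ℕ} (σ : Equiv.Perm (Fin N)) (i : ℕ) :
    IsDesc (List.ofFn fun p => (σ p : ℕ) + 1) i ↔ i + 1 ∈ descentSet σ := by
  simp only [IsDesc, descentSet, List.length_ofFn, List.getElem_ofFn, Set.mem_ofPred_eq,
    add_lt_add_iff_right, Fin.val_fin_lt]
  constructor
  · rintro ⟨h, h'⟩
    exact ⟨⟨i, by omega⟩, ⟨i + 1, h⟩, rfl, rfl, h'⟩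
  · rintro ⟨p, q, hp, hq, h⟩
    have hqN : i + 1 < N := hq ▸ q.2
    have hp' : p = ⟨i, i.lt_succ_self.trans hqN⟩ := Fin.ext (Nat.succ_injective hp)
    have hq' : q = ⟨i + 1, hqN⟩ := Fin.ext hq
    exact ⟨hqN, hp' ▸ hq' ▸ h⟩

theorem zero_notMem_descentSet {N : ℕ} (σ : Equiv.Perm (Fin N)) : 0 ∉ descentSet σ := by
  rintro ⟨p, q, hp, -⟩
  omega

/-- `IsDesc` indexes from `0` and so only sees positions `i + 1`; position `0` has to be ruled out
separately. -/
theorem descentSet_eq_iff {N : ℕ} (σ : Equiv.Perm (Fin N)) {D : Set ℕ} (hD : 0 ∉ D) :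
    descentSet σ = D ↔ ∀ i, i + 1 ∈ descentSet σ ↔ i + 1 ∈ D := by
  refine ⟨fun h i => by rw [h], fun h => Set.ext fun i => ?_⟩
  cases i with
  | zero => exact iff_of_false (zero_notMem_descentSet σ) hD
  | succ i => exact h i

theorem card_descentSet_eq {N : ℕ} {D : Set ℕ} (hD : 0 ∉ D) :
    Nat.card {σ : Equiv.Perm (Fin N) // descentSet σ = D} =
      arrangementCount (· ∈ D) (Finset.Icc 1 N) := by
  classical
  rw [Nat.card_eq_fintype_card, Fintype.card_subtype, arrangementCount]
  -- One-line notation; adding `1` moves the values from `Fin N` to `{1, …, N}`.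
  refine Finset.card_bij (fun σ _ => List.ofFn fun p => (σ p : ℕ) + 1) ?_ ?_ ?_
  · intro σ hσ
    have hσ := (descentSet_eq_iff σ hD).1 (Finset.mem_filter.1 hσ).2
    refine Finset.mem_filter.2 ⟨mem_arrangements.2 ⟨?_, ?_⟩, fun i => ?_⟩
    · rw [List.nodup_ofFn]
      intro p q h
      exact σ.injective (Fin.ext (Nat.succ_injective h))
    · ext x
      simp only [List.mem_toFinset, List.mem_ofFn, Finset.mem_Icc]
      constructor
      · rintro ⟨p, rfl⟩
        exact ⟨by omega, (σ p).2⟩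
      · rintro ⟨h1, h2⟩
        refine ⟨σ.symm ⟨x - 1, by omega⟩, ?_⟩
        rw [Equiv.apply_symm_apply]
        exact Nat.sub_add_cancel h1
    · rw [isDesc_ofFn_iff, hσ]
  · intro σ _ τ _ h
    have h := List.ofFn_injective h
    exact Equiv.ext fun p => Fin.ext (Nat.succ_injective (congrFun h p))
  · intro l hl
    obtain ⟨hl, hd⟩ := Finset.mem_filter.1 hl
    obtain ⟨hn, hX⟩ := mem_arrangements.1 hl
    have hlen : l.length = N := by rw [length_of_mem_arrangements hl]; simp
    subst hlen
    have hmem : ∀ p : Fin l.length, 1 ≤ l.get p ∧ l.get p ≤ l.length := fun p => by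
      rw [← Finset.mem_Icc, ← hX, List.mem_toFinset]
      exact List.get_mem l p
    let f : Fin l.length → Fin l.length := fun p =>
      ⟨l.get p - 1, by have := hmem p; omega⟩
    have hf : Function.Injective f := fun p q h => by
      have h1 : l.get p - 1 = l.get q - 1 := congrArg Fin.val h
      have h2 := hmem p
      have h3 := hmem q
      exact hn.injective_get (by omega)
    let σ : Equiv.Perm (Fin l.length) := Equiv.ofBijective f (Finite.injective_iff_bijective.1 hf)
    have hσ : (List.ofFn fun p => (σ p : ℕ) + 1) = l := by
      conv_rhs => rw [← List.ofFn_get l]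
      congr 1
      funext p
      exact Nat.sub_add_cancel (hmem p).1
    refine ⟨σ, Finset.mem_filter.2 ⟨Finset.mem_univ _, (descentSet_eq_iff σ hD).2 fun i => ?_⟩, hσ⟩
    rw [← isDesc_ofFn_iff, hσ, hd]

theorem length_blockWord (r n k : ℕ) (hr : 1 ≤ r) :
    (blockWord r n k).length = r * n + (k - 1) := by
  simp only [blockWord, List.length_append, List.length_flatten, List.map_replicate,
    List.length_replicate, List.length_singleton, List.sum_replicate, smul_eq_mul,
    Nat.sub_add_cancel hr]
  rw [mul_comm]

theorem blockWord_succ (r n k : ℕ) :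
    blockWord r (n + 1) k =
      (List.replicate (r - 1) ABLetter.a ++ [ABLetter.b]) ++ blockWord r n k := by
  simp only [blockWord, List.replicate_succ, List.flatten_cons, List.append_assoc]

theorem getElem_blockWord {r : ℕ} (hr : 1 ≤ r) (n k i : ℕ)
    (hi : i < (blockWord r n k).length) :
    (blockWord r n k)[i] = ABLetter.b ↔ r ∣ i + 1 ∧ i + 1 ≤ r * n := by
  induction n generalizing i with
  | zero =>
    simp [blockWord]
  | succ n ih =>
    have hlen : (List.replicate (r - 1) ABLetter.a ++ [ABLetter.b]).length = r := by
      simp [Nat.sub_add_cancel hr]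
    simp only [blockWord_succ] at hi ⊢
    rw [mul_add, mul_one]
    by_cases h : i < r
    · rw [List.getElem_append_left (by rwa [hlen])]
      rcases Nat.lt_or_ge i (r - 1) with h' | h'
      · rw [List.getElem_append_left (by simpa using h'), List.getElem_replicate]
        refine iff_of_false (by simp) fun hd => ?_
        have := Nat.le_of_dvd (Nat.succ_pos i) hd.1
        omega
      · obtain rfl : i = r - 1 := by omega
        rw [Nat.sub_add_cancel hr]
        refine iff_of_true ?_ ⟨dvd_rfl, by omega⟩
        simp
    · rw [List.getElem_append_right (by rw [hlen]; omega)]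
      simp only [hlen]
      rw [ih]
      obtain ⟨c, rfl⟩ := Nat.exists_eq_add_of_le (show r ≤ i by omega)
      rw [Nat.add_sub_cancel_left, add_assoc r c 1, Nat.dvd_add_right dvd_rfl]
      exact and_congr_right fun _ => by omega

theorem getElem_descentWord {N : ℕ} (σ : Equiv.Perm (Fin N)) (i : ℕ)
    (hi : i < (descentWord σ).length) :
    (descentWord σ)[i] = ABLetter.b ↔ i + 1 ∈ descentSet σ := by
  have hi' : i + 1 < N := by
    rw [descentWord, List.length_ofFn] at hi
    omega
  simp only [descentWord, List.getElem_ofFn]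
  rw [← isDesc_ofFn_iff]
  simp only [IsDesc, List.length_ofFn, List.getElem_ofFn, add_lt_add_iff_right, Fin.val_fin_lt]
  split_ifs with h
  · exact iff_of_false (by simp) fun ⟨_, h'⟩ => lt_asymm h h'
  · refine iff_of_true rfl ⟨hi', lt_of_le_of_ne (not_lt.1 h) fun h' => ?_⟩
    have := congrArg Fin.val (σ.injective h')
    simp at this

theorem lt_of_mem_descentSet {N : ℕ} {σ : Equiv.Perm (Fin N)} {i : ℕ} (hi : i ∈ descentSet σ) :
    i < N := by
  obtain ⟨-, q, -, rfl, -⟩ := hi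
  exact q.2

/-- With two letters, words can be compared through the positions of `b` alone. -/
theorem ABLetter.eq_iff {x y : ABLetter} : x = y ↔ (x = ABLetter.b ↔ y = ABLetter.b) := by
  cases x <;> cases y <;> simp

theorem mem_multiples_iff {r n i : ℕ} :
    (∃ t : ℕ, 1 ≤ t ∧ t ≤ n ∧ i + 1 = t * r) ↔ r ∣ i + 1 ∧ i + 1 ≤ r * n := by
  constructor
  · rintro ⟨t, -, htn, h⟩
    rw [h, mul_comm t]
    exact ⟨⟨t, rfl⟩, Nat.mul_le_mul_left r htn⟩
  · rintro ⟨⟨t, h⟩, h'⟩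
    rw [h] at h'
    have hr : 0 < r := Nat.pos_of_ne_zero (by rintro rfl; simp at h)
    refine ⟨t, Nat.one_le_iff_ne_zero.2 ?_, Nat.le_of_mul_le_mul_left h' hr, by rw [h, mul_comm]⟩
    rintro rfl
    simp at h

theorem zero_notMem_multiples {r n : ℕ} (hr : 1 ≤ r) :
    0 ∉ {i : ℕ | ∃ t : ℕ, 1 ≤ t ∧ t ≤ n ∧ i = t * r} := by
  rintro ⟨t, ht, -, h⟩
  exact (Nat.mul_pos ht hr).ne h

theorem descentWord_eq_blockWord_iff {r k n N : ℕ} (hr : 1 ≤ r) (hk : 1 ≤ k) (hN : N = r * n + k)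
    (σ : Equiv.Perm (Fin N)) :
    descentWord σ = blockWord r n k ↔
      descentSet σ = {i : ℕ | ∃ t : ℕ, 1 ≤ t ∧ t ≤ n ∧ i = t * r} := by
  have hlen : (descentWord σ).length = N - 1 := List.length_ofFn
  have hlen' : (blockWord r n k).length = N - 1 := by rw [length_blockWord r n k hr]; omega
  rw [descentSet_eq_iff σ (zero_notMem_multiples hr), List.ext_getElem_iff,
    and_iff_right (hlen.trans hlen'.symm)]
  simp only [Set.mem_ofPred_eq, mem_multiples_iff]
  constructor
  · intro h i
    by_cases hi : i < N - 1
    · have h1 := h i (by rwa [hlen]) (by rwa [hlen'])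
      rw [ABLetter.eq_iff, getElem_descentWord, getElem_blockWord hr] at h1
      exact h1
    -- Past the end of the word both sides fail: `i + 1 ≥ N > r * n`, since `k ≥ 1`.
    · refine iff_of_false (fun h' => ?_) fun h' => ?_
      · have := lt_of_mem_descentSet h'
        omega
      · omega
  · intro h i h1 h2
    rw [ABLetter.eq_iff, getElem_descentWord, getElem_blockWord hr]
    exact h i

theorem descentCount_blockWord {r k : ℕ} (hr : 1 ≤ r) (hk : 1 ≤ k) (n : ℕ) :
    descentCount (blockWord r n k) = Nat.card {σ : Equiv.Perm (Fin (r * n + k)) //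
      descentSet σ = {i : ℕ | ∃ t : ℕ, 1 ≤ t ∧ t ≤ n ∧ i = t * r}} := by
  have hN : (blockWord r n k).length + 1 = r * n + k := by
    rw [length_blockWord r n k hr]
    omega
  rw [descentCount, ← hN]
  exact Nat.card_congr
    (Equiv.subtypeEquivRight fun σ => descentWord_eq_blockWord_iff hr hk hN σ)

theorem mainTheorem1 (r k n : ℕ) (hr : 1 ≤ r) (hk : 1 ≤ k) :
    ExtPartitionLattice.moebius r n (k + 1) =
        (-1 : ℤ) ^ (n + 1) *
          (Nat.card {σ : Equiv.Perm (Fin (r * n + k)) //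
            descentSet σ = {i : ℕ | ∃ t : ℕ, 1 ≤ t ∧ t ≤ n ∧ i = t * r}} : ℤ) ∧
      ExtPartitionLattice.moebius r n (k + 1) =
        (-1 : ℤ) ^ (n + 1) * (descentCount (blockWord r n k) : ℤ) := by
  rw [descentCount_blockWord hr hk, and_self, card_descentSet_eq (zero_notMem_multiples hr),
    ExtPartitionLattice.moebius_eq_neg_blockSum (by omega),
    blockSum_isBlock_eq hr k n (Finset.mem_Icc.2 ⟨by omega, le_rfl⟩) (by simp; omega)]
  -- Deleting `m` from `[m]` leaves the ground set `[m-1]` of the permutations.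
  have hX : (Finset.Icc 1 (r * n + (k + 1))).erase (r * n + (k + 1)) =
      Finset.Icc 1 (r * n + k) := by
    ext i
    simp only [Finset.mem_erase, Finset.mem_Icc]
    omega
  rw [hX, arrangementCount_congr
    (D' := (· ∈ {i : ℕ | ∃ t : ℕ, 1 ≤ t ∧ t ≤ n ∧ i = t * r})), pow_succ]
  · ring
  · intro i
    simp [IsMultipleBetween, mem_multiples_iff]
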